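/- Let $n\ge 2$ and let $\mathbb{R}_n$ be the real Clifford algebra generated by $e_1,\dots,e_n$ with $e_i^2=-1$ and $e_ie_j=-e_je_i$ for $i\ne j$. For $x=\sum_A x_Ae_A\in\mathbb{R}_n$ write $\mathrm{Sc}(x)=x_\emptyset$, $|x|=(\sum_A x_A^2)^{1/2}$, and let $\overline{x}$ be the Clifford conjugate (the linear anti-automorphism with $\overline{e_i}=-e_i$). Let $\mathbb{R}^{n+1}\subset\mathbb{R}_n$ be the set of paravectors $s=s_0+\sum_{i=1}^n s_ie_i$. Put $\alpha_n=\frac{n-1}{2}$ and $\beta_n=\alpha_n+\alpha_n^2$. Let $\Omega\subset\{(x_1,\dots,x_{n-1},y): y>0\}\subset\mathbb{R}^n$ be an open set with $\inf_\Omega y=m$ and $\sup_\Omega y=M$, where $0<m<M<\infty$, and write $x_n=y$. Let $\langle F,G\rangle_2=\int_\Omega\overline{F}\,G\,dx$ and $\|F\|_2=(\mathrm{Sc}\langle F,F\rangle_2)^{1/2}$ on $L^2(\Omega)=L^2(\Omega,\mathbb{R}_n)$ (Lebesgue measure). Let $H^1(\Omega)$ be the Sobolev space of $\mathbb{R}_n$-valued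 $L^2$ functions with weak first derivatives in $L^2$, and $H_0^1(\Omega)$ the closure of $C_c^\infty(\Omega,\mathbb{R}_n)$ in it. Let $$\mathcal{D}_H=\sum_{i=1}^{n-1}e_iy\,\partial_{x_i}-\alpha_ne_n+e_ny\,\partial_y$$ be the Dirac operator on the hyperbolic space. For a paravector $s$, the sesquilinear form on $H^1_0(\Omega)$ associated with $Q_s(\mathcal{D}_H)=\mathcal{D}_H^2-2s_0\mathcal{D}_H+|s|^2$ is $$q_s(F,G)=\sum_{i=1}^{n}\langle y^2\partial_{x_i}F,\partial_{x_i}G\rangle_2+2(1+\alpha_n)\langle y\,\partial_yF,G\rangle_2+\langle(e_n-2s_0)\mathcal{D}_HF,G\rangle_2+(|s|^2-\beta_n)\langle F,G\rangle_2 .$$ For $f\in L^2(\Omega)$ denote by $Q_s(\mathcal{D}_H)^{-1}f$ the weak solution of $Q_s(\mathcal{D}_H)F=f$ with Dirichlet boundary condition, that is, the unique $F\in H_0^1(\Omega)$ with $q_s(F,G)=\langle f,G\rangle_2$ for all $G\in H_0^1(\Omega)$, when it exists, and put $S_R^{-1}(s,\mathcal{D}_H)f=(\overline{s}-\mathcal{D}_H)Q_s(\mathcal{D}_H)^{-1}f$.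 Suppose that the paravector $s$ satisfies $$\big||s|^2-\beta_n\big|-\alpha_n\sqrt{1+4s_0^2}+m^2>0$$ and $$4m^2\big||s|^2-\beta_n\big|-4nM^2s_0^2-4\big(m^2\alpha_n+M^2(1+\alpha_n)\sqrt{n}\big)\sqrt{1+4s_0^2}>M^2\big(4(1+\alpha_n)^2+n\big).$$ Then the number $$K_{n,m,M}(s)=\tfrac12\big||s|^2-\beta_n\big|-\tfrac12\alpha_n\sqrt{1+4s_0^2}+\tfrac12m^2-\tfrac12\sqrt{\Big(\big||s|^2-\beta_n\big|-\alpha_n\sqrt{1+4s_0^2}-m^2\Big)^2+M^2\Big(2(1+\alpha_n)+\sqrt{n}\sqrt{1+4s_0^2}\Big)^2}$$ is positive, and for every $f\in L^2(\Omega)$ the weak solution $Q_s(\mathcal{D}_H)^{-1}f$ exists and is unique, $S_R^{-1}(s,\mathcal{D}_H)f\in L^2(\Omega)$, and $$\|S_R^{-1}(s,\mathcal{D}_H)f\|_2\le\Big(|s|+\alpha_n+M\sqrt{n}\Big)\frac{1}{K_{n,m,M}(s)}\,\|f\|_2 .$$ -/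

import Mathlib

open MeasureTheory
open scoped symmDiff ContDiff

noncomputable section

/-! ### The real Clifford algebra with `n` imaginary units

An element is `∑_A x_A e_A`, with `A` running over the subsets of `{1, …, n}` (indexed here by
`Fin n`), where `e_A` is the product of the `e_i`, `i ∈ A`, in increasing order. The norm is the
Euclidean norm `(∑_A x_A ^ 2) ^ (1/2)` of the coefficients. -/

/-- The Clifford numbers `∑_A x_A e_A`. -/
abbrev Cl (n : ℕ) : Type := EuclideanSpace ℝ (Finset (Fin n))

namespace Cl

variable {n : ℕ}

/-- The basis vector `e_A`. -/
def basis (A : Finset (Fin n)) : Cl n := EuclideanSpace.single A 1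

/-- The sign in `e_A e_B = sign A B • e_{A ∆ B}`: sorting `e_A e_B` needs one transposition for
every pair `(a, b) ∈ A × B` with `b < a`, and every common index contributes `e_a ^ 2 = -1`. -/
def sign (A B : Finset (Fin n)) : ℝ :=
  (-1) ^ ((A ×ˢ B).filter (fun p => p.2 ≤ p.1)).card

lemma sign_eq_prod (A B : Finset (Fin n)) :
    sign A B = ∏ a ∈ A, ∏ b ∈ B, (if b ≤ a then (-1 : ℝ) else 1) := by
  rw [← Finset.prod_product' A B (fun a b => if b ≤ a then (-1 : ℝ) else 1), ← Finset.prod_filter,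
    Finset.prod_const, sign]

lemma prod_symmDiff (f : Fin n → ℝ) (hf : ∀ a, f a * f a = 1) (A B : Finset (Fin n)) :
    ∏ a ∈ A ∆ B, f a = (∏ a ∈ A, f a) * ∏ a ∈ B, f a := by
  have h1 : ∏ a ∈ A ∆ B, f a = (∏ a ∈ A \ B, f a) * ∏ a ∈ B \ A, f a := by
    rw [← Finset.prod_union (disjoint_sdiff_sdiff)]; rfl
  have hA : (∏ a ∈ A ∩ B, f a) * (∏ a ∈ A \ B, f a) = ∏ a ∈ A, f a :=
    Finset.prod_inter_mul_prod_sdiff A B f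
  have hB : (∏ a ∈ B ∩ A, f a) * (∏ a ∈ B \ A, f a) = ∏ a ∈ B, f a :=
    Finset.prod_inter_mul_prod_sdiff B A f
  have hI : (∏ a ∈ A ∩ B, f a) * (∏ a ∈ A ∩ B, f a) = 1 := by
    rw [← Finset.prod_mul_distrib]; exact Finset.prod_eq_one fun a _ => hf a
  rw [h1, ← hA, ← hB, Finset.inter_comm B A]
  linear_combination (-(∏ a ∈ A \ B, f a) * ∏ a ∈ B \ A, f a) * hI

lemma ite_sq (p : Prop) [Decidable p] :
    (if p then (-1 : ℝ) else 1) * (if p then (-1 : ℝ) else 1) = 1 := by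
  split_ifs <;> norm_num

lemma sign_symmDiff_left (A B C : Finset (Fin n)) :
    sign (A ∆ B) C = sign A C * sign B C := by
  simp only [sign_eq_prod]
  refine prod_symmDiff _ (fun a => ?_) A B
  rw [← Finset.prod_mul_distrib]
  exact Finset.prod_eq_one fun b _ => ite_sq _

lemma sign_symmDiff_right (A B C : Finset (Fin n)) :
    sign A (B ∆ C) = sign A B * sign A C := by
  simp only [sign_eq_prod]
  rw [← Finset.prod_mul_distrib]
  exact Finset.prod_congr rfl fun a _ => prod_symmDiff _ (fun b => ite_sq _) B C

/-- The bilinear product with `e_A e_B = sign A B • e_{A ∆ B}`. -/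
def mul (x y : Cl n) : Cl n :=
  ∑ A, ∑ B, (x A * y B * sign A B) • basis (A ∆ B)

instance : Mul (Cl n) := ⟨mul⟩

instance : One (Cl n) := ⟨basis ∅⟩

lemma mul_def (x y : Cl n) :
    x * y = ∑ A, ∑ B, (x A * y B * sign A B) • basis (A ∆ B) := rfl

lemma one_def : (1 : Cl n) = basis ∅ := rfl

lemma basis_mul_basis (A B : Finset (Fin n)) :
    basis A * basis B = sign A B • basis (A ∆ B) := by
  rw [mul_def, Finset.sum_eq_single A, Finset.sum_eq_single B]
  · simp [basis]
  · intro C _ hC; simp [basis, hC]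
  · simp
  · intro C _ hC; simp [basis, hC]
  · simp

lemma add_mul' (x y z : Cl n) : (x + y) * z = x * z + y * z := by
  simp only [mul_def, PiLp.add_apply, ← Finset.sum_add_distrib, ← add_smul]
  simp only [add_mul]

lemma mul_add' (x y z : Cl n) : x * (y + z) = x * y + x * z := by
  simp only [mul_def, PiLp.add_apply, ← Finset.sum_add_distrib, ← add_smul]
  simp only [add_mul, mul_add]

lemma smul_mul' (c : ℝ) (x y : Cl n) : (c • x) * y = c • (x * y) := by
  simp only [mul_def, PiLp.smul_apply, Finset.smul_sum, smul_smul, smul_eq_mul, mul_assoc]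

lemma mul_smul' (c : ℝ) (x y : Cl n) : x * (c • y) = c • (x * y) := by
  simp only [mul_def, PiLp.smul_apply, Finset.smul_sum, smul_smul, smul_eq_mul]
  refine Finset.sum_congr rfl fun A _ => Finset.sum_congr rfl fun B _ => ?_
  congr 1; ring

lemma sum_basis (x : Cl n) : x = ∑ A, x A • basis A := by
  ext B
  simp [basis, Finset.sum_apply, Pi.single_apply]

/-- Induction on Clifford numbers: additive, homogeneous, true on the basis. -/
lemma induction {P : Cl n → Prop} (h0 : P 0) (ha : ∀ x y, P x → P y → P (x + y))
    (hs : ∀ (c : ℝ) x, P x → P (c • x)) (hb : ∀ A, P (basis A)) (x : Cl n) : P x := by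
  rw [sum_basis x]
  exact Finset.sum_induction _ P ha h0 fun A _ => hs _ _ (hb A)

lemma zero_mul' (x : Cl n) : 0 * x = 0 := by simp [mul_def]

lemma mul_zero' (x : Cl n) : x * 0 = 0 := by simp [mul_def]

lemma one_mul' (x : Cl n) : 1 * x = x := by
  refine induction (P := fun x => 1 * x = x) (mul_zero' 1) (fun x y hx hy => ?_) (fun c x hx => ?_) (fun A => ?_) x
  · rw [mul_add', hx, hy]
  · rw [mul_smul', hx]
  · rw [one_def, basis_mul_basis, show (∅ : Finset (Fin n)) = ⊥ from rfl, bot_symmDiff]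
    simp [sign]

lemma mul_one' (x : Cl n) : x * 1 = x := by
  refine induction (P := fun x => x * 1 = x) (zero_mul' 1) (fun x y hx hy => ?_) (fun c x hx => ?_) (fun A => ?_) x
  · rw [add_mul', hx, hy]
  · rw [smul_mul', hx]
  · rw [one_def, basis_mul_basis, show (∅ : Finset (Fin n)) = ⊥ from rfl, symmDiff_bot]
    simp [sign]

lemma mul_assoc' (x y z : Cl n) : x * y * z = x * (y * z) := by
  refine induction (P := fun x => x * y * z = x * (y * z)) (by simp only [zero_mul'])
    (fun a b ha hb => ?_) (fun c a ha => ?_) (fun A => ?_) x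
  · simp only [add_mul', ha, hb]
  · simp only [smul_mul', ha]
  refine induction (P := fun y => basis A * y * z = basis A * (y * z))
    (by simp only [zero_mul', mul_zero']) (fun a b ha hb => ?_) (fun c a ha => ?_) (fun B => ?_) y
  · simp only [add_mul', mul_add', ha, hb]
  · simp only [smul_mul', mul_smul', ha]
  refine induction (P := fun z => basis A * basis B * z = basis A * (basis B * z))
    (by simp only [mul_zero']) (fun a b ha hb => ?_) (fun c a ha => ?_) (fun C => ?_) z
  · simp only [mul_add', ha, hb]
  · simp only [mul_smul', ha]
  simp only [basis_mul_basis, smul_mul', mul_smul', smul_smul, sign_symmDiff_left,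
    sign_symmDiff_right, symmDiff_assoc]
  congr 1; ring

instance : Ring (Cl n) :=
  { (inferInstance : AddCommGroup (Cl n)) with
    mul := (· * ·)
    one := 1
    left_distrib := mul_add'
    right_distrib := add_mul'
    zero_mul := zero_mul'
    mul_zero := mul_zero'
    mul_assoc := mul_assoc'
    one_mul := one_mul'
    mul_one := mul_one' }

instance : Algebra ℝ (Cl n) := Algebra.ofModule smul_mul' mul_smul'

/-- The imaginary unit `e_i`. -/
def e (i : Fin n) : Cl n := basis {i}

lemma e_mul_self (i : Fin n) : e i * e i = -1 := by
  rw [e, basis_mul_basis, symmDiff_self, one_def]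
  simp [sign, Finset.filter_singleton]

lemma e_mul_e {i j : Fin n} (h : i ≠ j) : e i * e j = -(e j * e i) := by
  rw [e, e, basis_mul_basis, basis_mul_basis, symmDiff_comm ({j} : Finset (Fin n)),
    ← neg_smul]
  congr 1
  rcases lt_or_gt_of_ne h with h | h <;>
    simp [sign, Finset.filter_singleton, h.le, not_le.mpr h]

/-- `e_A` is the product of the imaginary units `e_i`, `i ∈ A`, in increasing order. -/
lemma basis_eq_prod (A : Finset (Fin n)) : basis A = ((A.sort (· ≤ ·)).map e).prod := by
  induction A using Finset.induction_on_min with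
  | empty => simp [one_def]
  | insert a A ha ih =>
    have haA : a ∉ A := fun h => lt_irrefl _ (ha a h)
    rw [Finset.sort_insert (r := (· ≤ ·)) (fun b hb => (ha b hb).le) haA, List.map_cons,
      List.prod_cons, ← ih, e, basis_mul_basis]
    have h1 : ({a} : Finset (Fin n)) ∆ A = insert a A := by
      rw [(Finset.disjoint_singleton_left.mpr haA).symmDiff_eq_sup]; rfl
    have h2 : sign {a} A = 1 := by
      rw [sign_eq_prod, Finset.prod_singleton]
      exact Finset.prod_eq_one fun b hb => if_neg (not_le.mpr (ha b hb))
    rw [h1, h2, one_smul]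

/-- The scalar part `Sc x = x_∅`. -/
def sc (x : Cl n) : ℝ := x ∅

/-- Clifford conjugation: the linear map with `conj e_A = sign A A • e_A`, where
`sign A A = (-1) ^ (|A| (|A| + 1) / 2)`. It is the anti-automorphism with `conj e_i = -e_i`. -/
def conj (x : Cl n) : Cl n := ∑ A, (sign A A * x A) • basis A

lemma conj_add (x y : Cl n) : conj (x + y) = conj x + conj y := by
  simp only [conj, PiLp.add_apply, mul_add, add_smul, Finset.sum_add_distrib]

lemma conj_smul (c : ℝ) (x : Cl n) : conj (c • x) = c • conj x := by
  simp only [conj, PiLp.smul_apply, smul_eq_mul, Finset.smul_sum, smul_smul]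
  refine Finset.sum_congr rfl fun A _ => ?_
  congr 1; ring

lemma conj_basis (A : Finset (Fin n)) : conj (basis A) = sign A A • basis A := by
  rw [conj, Finset.sum_eq_single A]
  · simp [basis]
  · intro B _ hB; simp [basis, hB]
  · simp

lemma conj_e (i : Fin n) : conj (e i) = -e i := by
  rw [e, conj_basis]; simp [sign, Finset.filter_singleton]

lemma conj_mul (x y : Cl n) : conj (x * y) = conj y * conj x := by
  have h0 : conj (0 : Cl n) = 0 := by simp [conj]
  refine induction (P := fun x => conj (x * y) = conj y * conj x) (by simp [h0])
    (fun a b ha hb => ?_) (fun c a ha => ?_) (fun A => ?_) x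
  · rw [add_mul, conj_add, conj_add, ha, hb, mul_add]
  · rw [smul_mul', conj_smul, conj_smul, ha, mul_smul']
  refine induction (P := fun y => conj (basis A * y) = conj y * conj (basis A)) (by simp [h0])
    (fun a b ha hb => ?_) (fun c a ha => ?_) (fun B => ?_) y
  · rw [mul_add, conj_add, conj_add, ha, hb, add_mul]
  · rw [mul_smul', conj_smul, conj_smul, ha, smul_mul']
  simp only [basis_mul_basis, conj_smul, conj_basis, smul_mul', mul_smul', smul_smul,
    sign_symmDiff_left, sign_symmDiff_right, symmDiff_comm B A]
  congr 1
  have h : sign A B * sign A B = 1 := by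
    rw [← sign_symmDiff_right, symmDiff_self]; simp [sign]
  linear_combination (sign A A * sign B A * sign B B) * h

/-- The paravectors `x_0 + ∑_i x_i e_i`, a copy of `ℝ^{n+1}` in the Clifford algebra. -/
def paravectors (n : ℕ) : Set (Cl n) :=
  {x | ∃ (x₀ : ℝ) (v : Fin n → ℝ), x = x₀ • (1 : Cl n) + ∑ i, v i • e i}

end Cl

/-! ### Clifford-valued `L²` and Sobolev spaces -/

variable {n : ℕ}

/-- `L²(Ω, ℝ_n)`, with respect to Lebesgue measure. -/
abbrev L2 (Ω : Set (EuclideanSpace ℝ (Fin n))) : Type :=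
  Lp (Cl n) 2 (volume.restrict Ω)

/-- The Clifford-valued pairing `⟨F, G⟩₂ = ∫_Ω conj F * G dx`. -/
def pairing (Ω : Set (EuclideanSpace ℝ (Fin n))) (F G : EuclideanSpace ℝ (Fin n) → Cl n) : Cl n :=
  ∫ x in Ω, Cl.conj (F x) * G x

/-- The classical partial derivative `∂_j φ`. -/
def pderiv {V : Type*} [NormedAddCommGroup V] [NormedSpace ℝ V] (j : Fin n)
    (φ : EuclideanSpace ℝ (Fin n) → V) (x : EuclideanSpace ℝ (Fin n)) : V :=
  fderiv ℝ φ x (EuclideanSpace.single j 1)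

/-- `φ ∈ C_c^∞(Ω, V)`, extended by zero to the whole space. -/
structure IsTestFunction {V : Type*} [NormedAddCommGroup V] [NormedSpace ℝ V]
    (Ω : Set (EuclideanSpace ℝ (Fin n))) (φ : EuclideanSpace ℝ (Fin n) → V) : Prop where
  smooth : ContDiff ℝ ∞ φ
  compact : HasCompactSupport φ
  support : tsupport φ ⊆ Ω

/-- `F'` is the `j`-th weak derivative of `F` in `Ω`. -/
def HasWeakDeriv (Ω : Set (EuclideanSpace ℝ (Fin n))) (j : Fin n) (F F' : L2 Ω) : Prop :=
  ∀ φ : EuclideanSpace ℝ (Fin n) → ℝ, IsTestFunction Ω φ →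
    ∫ x in Ω, pderiv j φ x • F x = -∫ x in Ω, φ x • F' x

/-- Pairs `(F, (F_1, …, F_n))` of `L²` functions, with the Hilbert norm
`(‖F‖₂ ^ 2 + ∑_j ‖F_j‖₂ ^ 2) ^ (1/2)`. -/
abbrev L2Grad (Ω : Set (EuclideanSpace ℝ (Fin n))) : Type :=
  WithLp 2 (L2 Ω × PiLp 2 (fun _ : Fin n => L2 Ω))

lemma IsTestFunction.memLp_pderiv {Ω : Set (EuclideanSpace ℝ (Fin n))}
    {φ : EuclideanSpace ℝ (Fin n) → ℝ} (h : IsTestFunction Ω φ) (j : Fin n) :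
    MemLp (pderiv j φ) 2 (volume.restrict Ω) := by
  have hc : Continuous (pderiv j φ) :=
    (h.smooth.continuous_fderiv (by simp)).clm_apply continuous_const
  have hs : HasCompactSupport (pderiv j φ) :=
    (h.compact.fderiv (𝕜 := ℝ)).comp_left
      (g := fun L : EuclideanSpace ℝ (Fin n) →L[ℝ] ℝ => L (EuclideanSpace.single j 1)) rfl
  exact (hc.memLp_of_hasCompactSupport hs).restrict _

lemma IsTestFunction.memLp {Ω : Set (EuclideanSpace ℝ (Fin n))}
    {φ : EuclideanSpace ℝ (Fin n) → ℝ} (h : IsTestFunction Ω φ) :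
    MemLp φ 2 (volume.restrict Ω) :=
  (h.smooth.continuous.memLp_of_hasCompactSupport h.compact).restrict _

lemma integrable_smul_L2 {Ω : Set (EuclideanSpace ℝ (Fin n))} {φ : EuclideanSpace ℝ (Fin n) → ℝ}
    (h : MemLp φ 2 (volume.restrict Ω)) (F : L2 Ω) :
    Integrable (fun x => φ x • F x) (volume.restrict Ω) :=
  memLp_one_iff_integrable.mp ((Lp.memLp F).smul h)

lemma integral_smul_add {Ω : Set (EuclideanSpace ℝ (Fin n))} {φ : EuclideanSpace ℝ (Fin n) → ℝ}
    (h : MemLp φ 2 (volume.restrict Ω)) (F G : L2 Ω) :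
    ∫ x in Ω, φ x • (F + G) x = (∫ x in Ω, φ x • F x) + ∫ x in Ω, φ x • G x := by
  rw [← integral_add (integrable_smul_L2 h F) (integrable_smul_L2 h G)]
  refine integral_congr_ae ?_
  filter_upwards [Lp.coeFn_add F G] with x hx
  rw [hx, Pi.add_apply, smul_add]

lemma integral_smul_smul {Ω : Set (EuclideanSpace ℝ (Fin n))} (φ : EuclideanSpace ℝ (Fin n) → ℝ)
    (c : ℝ) (F : L2 Ω) :
    ∫ x in Ω, φ x • (c • F) x = c • ∫ x in Ω, φ x • F x := by
  rw [← integral_smul]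
  refine integral_congr_ae ?_
  filter_upwards [Lp.coeFn_smul c F] with x hx
  rw [hx, Pi.smul_apply, smul_comm]

/-- The Sobolev space `H¹(Ω, ℝ_n)`. A function is stored together with its weak derivatives, which
it determines: `u.fst` is the function and `u.snd j` its `j`-th weak derivative. The norm is
`(‖F‖₂ ^ 2 + ∑_j ‖∂_j F‖₂ ^ 2) ^ (1/2)`. -/
def H1 (Ω : Set (EuclideanSpace ℝ (Fin n))) : Submodule ℝ (L2Grad Ω) where
  carrier := {u | ∀ j, HasWeakDeriv Ω j u.fst (u.snd j)}
  add_mem' := by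
    intro u v hu hv j φ hφ
    have h1 := integral_smul_add (hφ.memLp_pderiv j) u.fst v.fst
    have h2 := integral_smul_add hφ.memLp (u.snd j) (v.snd j)
    change ∫ x in Ω, pderiv j φ x • (u.fst + v.fst) x = -∫ x in Ω, φ x • (u.snd j + v.snd j) x
    rw [h1, h2, hu j φ hφ, hv j φ hφ, neg_add]
  zero_mem' := by
    intro j φ hφ
    have h1 := integral_smul_smul (Ω := Ω) (pderiv j φ) 0 0
    have h2 := integral_smul_smul (Ω := Ω) φ 0 0
    change ∫ x in Ω, pderiv j φ x • (0 : L2 Ω) x = -∫ x in Ω, φ x • (0 : L2 Ω) x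
    rw [zero_smul, zero_smul] at h1 h2
    rw [h1, h2, neg_zero]
  smul_mem' := by
    intro c u hu j φ hφ
    have h1 := integral_smul_smul (pderiv j φ) c u.fst
    have h2 := integral_smul_smul φ c (u.snd j)
    change ∫ x in Ω, pderiv j φ x • (c • u.fst) x = -∫ x in Ω, φ x • (c • u.snd j) x
    rw [h1, h2, hu j φ hφ, smul_neg]

/-- The function underlying an element of `H¹(Ω, ℝ_n)`. -/
def toFn {Ω : Set (EuclideanSpace ℝ (Fin n))} (F : H1 Ω) : L2 Ω := F.1.fst

/-- The weak derivative `∂_j F` of an element of `H¹(Ω, ℝ_n)`. -/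
def wderiv {Ω : Set (EuclideanSpace ℝ (Fin n))} (F : H1 Ω) (j : Fin n) : L2 Ω := F.1.snd j

/-- `H¹₀(Ω, ℝ_n)`: the closure of `C_c^∞(Ω, ℝ_n)` in `H¹(Ω, ℝ_n)`. -/
def H10 (Ω : Set (EuclideanSpace ℝ (Fin n))) : Set (H1 Ω) :=
  closure {F | ∃ φ : EuclideanSpace ℝ (Fin n) → Cl n, IsTestFunction Ω φ ∧
    toFn F =ᵐ[volume.restrict Ω] φ}

/-! ### The Dirac operator on the hyperbolic upper half-space -/

/-- The index of the last coordinate `y = x_n`. -/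
def lastIdx (n : ℕ) [NeZero n] : Fin n := ⟨n - 1, Nat.sub_one_lt (NeZero.ne n)⟩

/-- `α_n = (n - 1) / 2`. -/
def alpha (n : ℕ) : ℝ := ((n : ℝ) - 1) / 2

/-- `β_n = α_n + α_n ^ 2`. -/
def beta (n : ℕ) : ℝ := alpha n + alpha n ^ 2

/-- The hyperbolic Dirac operator
`D_H F = ∑_{i < n} e_i y ∂_i F - α_n e_n F + e_n y ∂_n F`, `y = x_n`, with weak derivatives. -/
def diracH [NeZero n] {Ω : Set (EuclideanSpace ℝ (Fin n))} (F : H1 Ω)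
    (x : EuclideanSpace ℝ (Fin n)) : Cl n :=
  (∑ i ∈ Finset.univ.erase (lastIdx n), Cl.e i * (x (lastIdx n) • wderiv F i x))
    - alpha n • (Cl.e (lastIdx n) * toFn F x)
    + Cl.e (lastIdx n) * (x (lastIdx n) • wderiv F (lastIdx n) x)

/-- The sesquilinear form of `Q_s(D_H) = D_H ^ 2 - 2 s_0 D_H + |s| ^ 2`, where
`D_H ^ 2 = -y ^ 2 Δ + e_n D_H + 2 α_n y ∂_y - β_n` and the Laplacian is integrated by parts. -/
def qForm [NeZero n] {Ω : Set (EuclideanSpace ℝ (Fin n))} (s : Cl n) (F G : H1 Ω) : Cl n :=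
  (∑ i ∈ Finset.univ.erase (lastIdx n),
      pairing Ω (fun x => x (lastIdx n) ^ 2 • wderiv F i x) (wderiv G i))
    + pairing Ω (fun x => x (lastIdx n) ^ 2 • wderiv F (lastIdx n) x) (wderiv G (lastIdx n))
    + (2 * (1 + alpha n)) • pairing Ω (fun x => x (lastIdx n) • wderiv F (lastIdx n) x) (toFn G)
    + pairing Ω (fun x => (Cl.e (lastIdx n) - (2 * Cl.sc s) • (1 : Cl n)) * diracH F x) (toFn G)
    + pairing Ω (fun x => (‖s‖ ^ 2 - beta n) • toFn F x) (toFn G)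

/-- `F` is a weak solution of `Q_s(D_H) F = f` in `Ω`, `F = 0` on `∂Ω`. -/
def IsWeakSolution [NeZero n] {Ω : Set (EuclideanSpace ℝ (Fin n))} (s : Cl n) (f : L2 Ω)
    (F : H1 Ω) : Prop :=
  F ∈ H10 Ω ∧ ∀ G ∈ H10 Ω, qForm s F G = pairing Ω f (toFn G)

/-- The pseudo `S`-resolvent `Q_s(D_H)⁻¹ f`: the weak solution of `Q_s(D_H) F = f`, `F = 0` on
`∂Ω` (an arbitrary element of `H¹` if there is none). -/
def pseudoSResolvent [NeZero n] {Ω : Set (EuclideanSpace ℝ (Fin n))} (s : Cl n) (f : L2 Ω) :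
    H1 Ω :=
  Classical.epsilon (IsWeakSolution s f)

/-- The right `S`-resolvent `S_R⁻¹(s, D_H) f = (conj s - D_H) Q_s(D_H)⁻¹ f`. -/
def rightSResolvent [NeZero n] {Ω : Set (EuclideanSpace ℝ (Fin n))} (s : Cl n) (f : L2 Ω)
    (x : EuclideanSpace ℝ (Fin n)) : Cl n :=
  Cl.conj s * toFn (pseudoSResolvent s f) x - diracH (pseudoSResolvent s f) x

/-- The constant `K_{n,m,M}(s)`. -/
def coercivityConst (m M : ℝ) (s : Cl n) : ℝ :=
  1 / 2 * |‖s‖ ^ 2 - beta n| - 1 / 2 * alpha n * √(1 + 4 * Cl.sc s ^ 2) + 1 / 2 * m ^ 2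
    - 1 / 2 * √((|‖s‖ ^ 2 - beta n| - alpha n * √(1 + 4 * Cl.sc s ^ 2) - m ^ 2) ^ 2
        + M ^ 2 * (2 * (1 + alpha n) + √(n : ℝ) * √(1 + 4 * Cl.sc s ^ 2)) ^ 2)

end

/-! The proof is Lax–Milgram with an explicit coercivity constant. Put `p = ‖∇u‖`, `q = ‖u‖`, `r =
√(1 + 4 s₀²)`. On the strip the weight `y` lies in `[m, M]`, so the second-order terms of `Sc q_s(u,
u)` are at least `m² p²`. Left multiplication by the paravector `e_n - 2 s₀` scales norms by exactly
`r`, and `‖D_H u‖ ≤ M √n p + α_n q`. Cauchy–Schwarz then gives `Sc q_s(u, u) ≥ m² p² - B p q + A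
q²`, with `A = |s|² - β_n - α_n r` and `B = M (2 (1 + α_n) + √n r)` (`le_scFormL_self`). The second
hypothesis forces `|s|² ≥ β_n`. After that, `K` is the least eigenvalue of this quadratic form, and
the two hypotheses say that its trace and determinant are positive (`least_eigenvalue_mul_le`,
`least_eigenvalue_pos`). Coercivity uses neither a boundary condition nor a Poincaré inequality: it
holds for arbitrary tuples of `L²` functions, not only for a function and its gradient.

The weak equation is Clifford-valued, while Lax–Milgram is real. The two versions agree because
`q_s` is right linear in its second argument, `H¹₀` is stable under right multiplication, and `x` is
determined by the numbers `Sc (x a)` (`isWeakSolution_iff`). Testing with the solution itself gives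
`‖F‖_{H¹} ≤ ‖f‖ / K`, and the bound on `D_H` turns this into the estimate for the resolvent. -/

noncomputable section

/-! ### Conjugation, scalar part and norm in the Clifford algebra. -/

namespace Cl

variable {n : ℕ}

lemma sign_mul_self (A B : Finset (Fin n)) : sign A B * sign A B = 1 := by
  rw [← sign_symmDiff_right, symmDiff_self]; simp [sign]

lemma basis_apply (A B : Finset (Fin n)) : basis A B = if B = A then (1 : ℝ) else 0 := by
  simp [basis]

lemma sc_mul (x y : Cl n) : sc (x * y) = ∑ A, sign A A * x A * y A := by
  simp only [sc, mul_def, WithLp.ofLp_sum, Finset.sum_apply, PiLp.smul_apply, smul_eq_mul]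
  refine Finset.sum_congr rfl fun A _ => ?_
  rw [Finset.sum_eq_single A]
  · rw [symmDiff_self, basis_apply]; simp; ring
  · intro B _ hB
    rw [basis_apply, if_neg, mul_zero]
    intro h
    exact hB (symmDiff_eq_bot.mp h.symm).symm
  · simp

lemma conj_apply (x : Cl n) (A : Finset (Fin n)) : conj x A = sign A A * x A := by
  simp [conj, WithLp.ofLp_sum, Finset.sum_apply, basis_apply]

lemma conj_conj (x : Cl n) : conj (conj x) = x := by
  ext A
  rw [conj_apply, conj_apply, ← mul_assoc, sign_mul_self, one_mul]

lemma conj_one : conj (1 : Cl n) = 1 := by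
  rw [one_def, conj_basis]; simp [sign]

lemma conj_sum {ι : Type*} (t : Finset ι) (f : ι → Cl n) :
    conj (∑ i ∈ t, f i) = ∑ i ∈ t, conj (f i) := by
  classical
  induction t using Finset.induction_on with
  | empty => simp [conj]
  | insert a t ha ih => rw [Finset.sum_insert ha, Finset.sum_insert ha, conj_add, ih]

lemma sc_conj_mul (x y : Cl n) : sc (conj x * y) = inner ℝ x y := by
  rw [sc_mul, PiLp.inner_apply]
  refine Finset.sum_congr rfl fun A _ => ?_
  rw [conj_apply, ← mul_assoc, sign_mul_self, one_mul]
  simp [mul_comm]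

lemma norm_sq_eq_sc (x : Cl n) : ‖x‖ ^ 2 = sc (conj x * x) := by
  rw [sc_conj_mul, real_inner_self_eq_norm_sq]

lemma norm_conj (x : Cl n) : ‖conj x‖ = ‖x‖ := by
  have h : ‖conj x‖ ^ 2 = ‖x‖ ^ 2 := by
    rw [EuclideanSpace.norm_sq_eq, EuclideanSpace.norm_sq_eq]
    refine Finset.sum_congr rfl fun A _ => ?_
    rw [conj_apply, norm_mul, mul_pow, Real.norm_eq_abs, sq_abs, sq, sign_mul_self, one_mul]
  exact (sq_eq_sq₀ (norm_nonneg _) (norm_nonneg _)).mp h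

/-- The form `Sc (x a)` is the inner product of `conj x` with `a`, hence nondegenerate. This is how
Clifford-valued identities are recovered from real ones. -/
lemma eq_of_sc_mul_eq {x y : Cl n} (h : ∀ a, sc (x * a) = sc (y * a)) : x = y := by
  have h' : conj x = conj y := by
    refine ext_inner_right ℝ fun a => ?_
    rw [← sc_conj_mul, ← sc_conj_mul, conj_conj, conj_conj, h]
  rw [← conj_conj x, h', conj_conj]

/-- Adding the double sum to its transpose cancels the off-diagonal terms, since the units
anticommute. -/
lemma vector_mul_self (v : Fin n → ℝ) :
    (∑ i, v i • e i) * ∑ i, v i • e i = (-∑ i, v i ^ 2) • (1 : Cl n) := by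
  set S : Cl n := (∑ i, v i • e i) * ∑ i, v i • e i with hS
  have h1 : S = ∑ i, ∑ j, (v i * v j) • (e i * e j) := by
    simp only [hS, Finset.sum_mul_sum, smul_mul_smul_comm]
  have h2 : S = ∑ i, ∑ j, (v i * v j) • (e j * e i) := by
    rw [h1, Finset.sum_comm]
    simp only [mul_comm]
  have h3 : S + S = ∑ i, (-(2 * v i ^ 2)) • (1 : Cl n) := by
    nth_rewrite 1 [h1]
    rw [h2, ← Finset.sum_add_distrib]
    refine Finset.sum_congr rfl fun i _ => ?_
    rw [← Finset.sum_add_distrib, Finset.sum_eq_single i]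
    · rw [e_mul_self, smul_neg, ← neg_smul, ← add_smul]; congr 1; ring
    · intro j _ hj
      rw [e_mul_e hj, ← smul_add, add_neg_cancel, smul_zero]
    · simp
  have h4 : (2 : ℝ) • S = (2 : ℝ) • ((-∑ i, v i ^ 2) • (1 : Cl n)) := by
    rw [two_smul, h3, ← Finset.sum_smul, smul_smul]
    congr 1
    rw [Finset.sum_neg_distrib, ← Finset.mul_sum]; ring
  exact smul_right_injective _ two_ne_zero h4

lemma conj_paravector (x₀ : ℝ) (v : Fin n → ℝ) :
    conj (x₀ • (1 : Cl n) + ∑ i, v i • e i) = x₀ • (1 : Cl n) - ∑ i, v i • e i := by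
  rw [conj_add, conj_smul, conj_one, conj_sum, sub_eq_add_neg, ← Finset.sum_neg_distrib]
  simp only [conj_smul, conj_e, smul_neg]

lemma conj_mem_paravectors {s : Cl n} (hs : s ∈ paravectors n) : conj s ∈ paravectors n := by
  obtain ⟨x₀, v, rfl⟩ := hs
  refine ⟨x₀, fun i => -v i, ?_⟩
  rw [conj_paravector, sub_eq_add_neg, ← Finset.sum_neg_distrib]
  simp only [neg_smul]

lemma sc_one : sc (1 : Cl n) = 1 := by
  rw [sc, one_def, basis_apply, if_pos rfl]

lemma sc_smul (c : ℝ) (x : Cl n) : sc (c • x) = c * sc x := rfl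

lemma conj_mul_paravector (x₀ : ℝ) (v : Fin n → ℝ) :
    conj (x₀ • (1 : Cl n) + ∑ i, v i • e i) * (x₀ • (1 : Cl n) + ∑ i, v i • e i)
      = (x₀ ^ 2 + ∑ i, v i ^ 2) • (1 : Cl n) := by
  rw [conj_paravector, sub_mul, mul_add, mul_add, vector_mul_self]
  simp only [smul_mul_assoc, mul_smul_comm, one_mul, mul_one, smul_smul, neg_smul, add_smul, sq]
  abel

lemma norm_sq_paravector (x₀ : ℝ) (v : Fin n → ℝ) :
    ‖x₀ • (1 : Cl n) + ∑ i, v i • e i‖ ^ 2 = x₀ ^ 2 + ∑ i, v i ^ 2 := by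
  rw [norm_sq_eq_sc, conj_mul_paravector, sc_smul, sc_one, mul_one]

/-- For a paravector `conj s * s` is the real number `|s|²`, which can be pulled out of `Sc (conj x
* conj s * s * x)`. -/
lemma norm_mul_of_mem_paravectors {s : Cl n} (hs : s ∈ paravectors n) (x : Cl n) :
    ‖s * x‖ = ‖s‖ * ‖x‖ := by
  have h : ‖s * x‖ ^ 2 = (‖s‖ * ‖x‖) ^ 2 := by
    obtain ⟨x₀, v, rfl⟩ := hs
    rw [mul_pow, norm_sq_paravector, norm_sq_eq_sc (_ * x), norm_sq_eq_sc x, conj_mul, mul_assoc,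
      ← mul_assoc (conj (_ + _)), conj_mul_paravector, smul_mul_assoc, one_mul, mul_smul_comm,
      sc_smul]
  exact (sq_eq_sq₀ (norm_nonneg _) (by positivity)).mp h

lemma e_eq_paravector (i : Fin n) (c : ℝ) :
    e i + c • (1 : Cl n) = c • (1 : Cl n) + ∑ j, (Pi.single i 1 : Fin n → ℝ) j • e j := by
  rw [Finset.sum_eq_single i (fun j _ hj => by simp [hj]) (by simp)]
  simp [add_comm]

/-- With `c = -2 s₀` this treats the coefficient `e_n - 2 s₀` of `q_s`; it is the source of every
`√(1 + 4 s₀²)`. -/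
lemma norm_e_add_smul_one_mul (i : Fin n) (c : ℝ) (x : Cl n) :
    ‖(e i + c • (1 : Cl n)) * x‖ = √(1 + c ^ 2) * ‖x‖ := by
  rw [norm_mul_of_mem_paravectors ⟨c, _, e_eq_paravector i c⟩]
  congr 1
  rw [e_eq_paravector, ← Real.sqrt_sq (norm_nonneg (_ + _)), norm_sq_paravector, Finset.sum_eq_single i (fun j _ hj => by simp [hj]) (by simp)]
  simp [add_comm]

lemma norm_e_mul (i : Fin n) (x : Cl n) : ‖e i * x‖ = ‖x‖ := by
  simpa using norm_e_add_smul_one_mul i 0 x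

/-- Clifford conjugation as a linear map. -/
def conjₗ : Cl n →ₗ[ℝ] Cl n where
  toFun := conj
  map_add' := conj_add
  map_smul' := conj_smul

/-- Left multiplication as a continuous linear map. -/
def mulLeftL (a : Cl n) : Cl n →L[ℝ] Cl n := (LinearMap.mulLeft ℝ a).toContinuousLinearMap

/-- Right multiplication as a continuous linear map. -/
def mulRightL (a : Cl n) : Cl n →L[ℝ] Cl n := (LinearMap.mulRight ℝ a).toContinuousLinearMap

/-- The scalar part as a continuous linear map. -/
def scL : Cl n →L[ℝ] ℝ := EuclideanSpace.proj ∅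

/-- The bilinear map `(x, y) ↦ conj x * y`. -/
def conjMulL : Cl n →L[ℝ] Cl n →L[ℝ] Cl n :=
  ((LinearMap.mul ℝ (Cl n)).comp conjₗ).toContinuousBilinearMap

@[simp] lemma mulLeftL_apply (a x : Cl n) : mulLeftL a x = a * x := rfl

@[simp] lemma mulRightL_apply (a x : Cl n) : mulRightL a x = x * a := rfl

@[simp] lemma scL_apply (x : Cl n) : scL x = sc x := rfl

@[simp] lemma conjMulL_apply (x y : Cl n) : conjMulL x y = conj x * y := rfl

end Cl

variable {n : ℕ} {Ω : Set (EuclideanSpace ℝ (Fin n))}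

/-! ### The pairing as a continuous bilinear map -/

/-- The pairing `⟨F, G⟩₂` on `L²`, as a continuous bilinear map. -/
def pairingL (Ω : Set (EuclideanSpace ℝ (Fin n))) : L2 Ω →L[ℝ] L2 Ω →L[ℝ] Cl n :=
  ContinuousLinearMap.lpPairing (volume.restrict Ω) 2 2 Cl.conjMulL

lemma pairing_eq_pairingL {f g : EuclideanSpace ℝ (Fin n) → Cl n} {F G : L2 Ω}
    (hf : f =ᵐ[volume.restrict Ω] F) (hg : g =ᵐ[volume.restrict Ω] G) :
    pairing Ω f g = pairingL Ω F G := by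
  rw [pairingL, ContinuousLinearMap.lpPairing_eq_integral]
  refine integral_congr_ae ?_
  filter_upwards [hf, hg] with x hfx hgx
  rw [hfx, hgx, Cl.conjMulL_apply]

/-- Right multiplication by a Clifford number on `L²`. -/
def mulRightL2 (Ω : Set (EuclideanSpace ℝ (Fin n))) (a : Cl n) : L2 Ω →L[ℝ] L2 Ω :=
  (Cl.mulRightL a).compLpL 2 (volume.restrict Ω)

/-- Left multiplication by a Clifford number on `L²`. -/
def mulLeftL2 (Ω : Set (EuclideanSpace ℝ (Fin n))) (a : Cl n) : L2 Ω →L[ℝ] L2 Ω :=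
  (Cl.mulLeftL a).compLpL 2 (volume.restrict Ω)

lemma coeFn_mulRightL2 (a : Cl n) (F : L2 Ω) :
    mulRightL2 Ω a F =ᵐ[volume.restrict Ω] fun x => F x * a :=
  ContinuousLinearMap.coeFn_compLpL (Cl.mulRightL a) F

lemma coeFn_mulLeftL2 (a : Cl n) (F : L2 Ω) :
    mulLeftL2 Ω a F =ᵐ[volume.restrict Ω] fun x => a * F x :=
  ContinuousLinearMap.coeFn_compLpL (Cl.mulLeftL a) F

lemma norm_mulLeftL2_le {a : Cl n} {C : ℝ} (h : ∀ x, ‖a * x‖ ≤ C * ‖x‖) (F : L2 Ω) :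
    ‖mulLeftL2 Ω a F‖ ≤ C * ‖F‖ := by
  refine Lp.norm_le_mul_norm_of_ae_le_mul ?_
  filter_upwards [coeFn_mulLeftL2 a F] with x hx
  rw [hx]
  exact h _

/-- By associativity the factor `a` moves onto `G`, and the scalar part of `conj F * (G a)` is the
pointwise inner product. -/
lemma sc_pairingL_mul (F G : L2 Ω) (a : Cl n) :
    Cl.sc (pairingL Ω F G * a) = inner ℝ F (mulRightL2 Ω a G) := by
  have hint : Integrable (fun x => Cl.conjMulL (F x) (G x)) (volume.restrict Ω) :=
    memLp_one_iff_integrable.mp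
      (Cl.conjMulL.memLp_of_bilin 1 (Lp.memLp F) (Lp.memLp G))
  have h := ((Cl.scL (n := n)).comp (Cl.mulRightL a)).integral_comp_comm hint
  rw [pairingL, ContinuousLinearMap.lpPairing_eq_integral, L2.inner_def]
  refine h.symm.trans (integral_congr_ae ?_)
  filter_upwards [coeFn_mulRightL2 a G] with x hx
  rw [hx, ← Cl.sc_conj_mul, ← mul_assoc]
  rfl

/-! ### Multiplication by a bounded function -/

/-- Multiplication by a bounded real function on `L²`. -/
def weightL2 {w : EuclideanSpace ℝ (Fin n) → ℝ} (hw : MemLp w ⊤ (volume.restrict Ω)) :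
    L2 Ω →L[ℝ] L2 Ω :=
  (ContinuousLinearMap.lsmul ℝ ℝ).holderL (volume.restrict Ω) ⊤ 2 2 hw.toLp

lemma coeFn_weightL2 {w : EuclideanSpace ℝ (Fin n) → ℝ} (hw : MemLp w ⊤ (volume.restrict Ω))
    (F : L2 Ω) : weightL2 hw F =ᵐ[volume.restrict Ω] fun x => w x • F x := by
  filter_upwards [ContinuousLinearMap.coeFn_holder (r := 2)
    (ContinuousLinearMap.lsmul ℝ ℝ : ℝ →L[ℝ] Cl n →L[ℝ] Cl n) hw.toLp F, hw.coeFn_toLp]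
    with x hx hwx
  rw [← hwx]
  exact hx

lemma norm_weightL2_le {w : EuclideanSpace ℝ (Fin n) → ℝ} (hw : MemLp w ⊤ (volume.restrict Ω))
    {M : ℝ} (hM : ∀ᵐ x ∂volume.restrict Ω, |w x| ≤ M) (F : L2 Ω) :
    ‖weightL2 hw F‖ ≤ M * ‖F‖ := by
  refine Lp.norm_le_mul_norm_of_ae_le_mul ?_
  filter_upwards [coeFn_weightL2 hw F, hM] with x hx hMx
  rw [hx, norm_smul]
  exact mul_le_mul_of_nonneg_right hMx (norm_nonneg _)

lemma le_norm_weightL2 {w : EuclideanSpace ℝ (Fin n) → ℝ} (hw : MemLp w ⊤ (volume.restrict Ω))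
    {m : ℝ} (hm : 0 < m) (hmw : ∀ᵐ x ∂volume.restrict Ω, m ≤ |w x|) (F : L2 Ω) :
    m * ‖F‖ ≤ ‖weightL2 hw F‖ := by
  rw [← le_inv_mul_iff₀ hm]
  refine Lp.norm_le_mul_norm_of_ae_le_mul ?_
  filter_upwards [coeFn_weightL2 hw F, hmw] with x hx hmx
  rw [hx, norm_smul, le_inv_mul_iff₀ hm]
  exact mul_le_mul_of_nonneg_right hmx (norm_nonneg _)

lemma inner_weightL2_left {w : EuclideanSpace ℝ (Fin n) → ℝ}
    (hw : MemLp w ⊤ (volume.restrict Ω)) (F G : L2 Ω) :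
    inner ℝ (weightL2 hw F) G = inner ℝ F (weightL2 hw G) := by
  rw [L2.inner_def, L2.inner_def]
  refine integral_congr_ae ?_
  filter_upwards [coeFn_weightL2 hw F, coeFn_weightL2 hw G] with x h1 h2
  rw [h1, h2, real_inner_smul_left, real_inner_smul_right]

/-! ### The Sobolev spaces -/

/-- The function component of an element of `L2Grad`. -/
def valL (Ω : Set (EuclideanSpace ℝ (Fin n))) : L2Grad Ω →L[ℝ] L2 Ω :=
  WithLp.fstL 2 ℝ _ _

/-- The `j`-th derivative component of an element of `L2Grad`. -/
def gradL (Ω : Set (EuclideanSpace ℝ (Fin n))) (j : Fin n) : L2Grad Ω →L[ℝ] L2 Ω :=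
  (PiLp.proj 2 (fun _ : Fin n => L2 Ω) j).comp (WithLp.sndL 2 ℝ _ _)

lemma L2Grad_norm_sq (u : L2Grad Ω) :
    ‖u‖ ^ 2 = ‖valL Ω u‖ ^ 2 + ∑ j, ‖gradL Ω j u‖ ^ 2 := by
  rw [WithLp.prod_norm_sq_eq_of_L2, PiLp.norm_sq_eq_of_L2]
  rfl

/-- Against a fixed test function, both sides of the weak derivative identity are continuous in `u`,
so the space is an intersection of closed sets. Its completeness is needed for Lax–Milgram. -/
lemma isClosed_H1 : IsClosed (H1 Ω : Set (L2Grad Ω)) := by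
  have h : (H1 Ω : Set (L2Grad Ω)) = ⋂ j : Fin n, ⋂ φ : EuclideanSpace ℝ (Fin n) → ℝ,
      ⋂ hφ : IsTestFunction Ω φ, {u : L2Grad Ω |
        ContinuousLinearMap.lpPairing (volume.restrict Ω) 2 2
            (ContinuousLinearMap.lsmul ℝ ℝ : ℝ →L[ℝ] Cl n →L[ℝ] Cl n)
            (hφ.memLp_pderiv j).toLp (valL Ω u) =
          -ContinuousLinearMap.lpPairing (volume.restrict Ω) 2 2
            (ContinuousLinearMap.lsmul ℝ ℝ : ℝ →L[ℝ] Cl n →L[ℝ] Cl n)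
            hφ.memLp.toLp (gradL Ω j u)} := by
    ext u
    simp only [Set.mem_iInter, Set.mem_ofPred_eq, SetLike.mem_coe]
    refine forall_congr' fun j => forall_congr' fun φ => forall_congr' fun hφ => ?_
    rw [ContinuousLinearMap.lpPairing_eq_integral, ContinuousLinearMap.lpPairing_eq_integral]
    have h1 : ∫ x in Ω, pderiv j φ x • u.fst x = ∫ x in Ω,
        (ContinuousLinearMap.lsmul ℝ ℝ : ℝ →L[ℝ] Cl n →L[ℝ] Cl n)
          ((hφ.memLp_pderiv j).toLp (pderiv j φ) x) (valL Ω u x) := by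
      refine integral_congr_ae ?_
      filter_upwards [(hφ.memLp_pderiv j).coeFn_toLp] with x hx
      rw [hx]
      rfl
    have h2 : ∫ x in Ω, φ x • u.snd j x = ∫ x in Ω,
        (ContinuousLinearMap.lsmul ℝ ℝ : ℝ →L[ℝ] Cl n →L[ℝ] Cl n)
          (hφ.memLp.toLp φ x) (gradL Ω j u x) := by
      refine integral_congr_ae ?_
      filter_upwards [hφ.memLp.coeFn_toLp] with x hx
      rw [hx]
      rfl
    rw [← h1, ← h2]
  rw [h]
  refine isClosed_iInter fun j => isClosed_iInter fun φ => isClosed_iInter fun hφ =>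
    isClosed_eq ?_ ?_ <;> fun_prop

instance : CompleteSpace (H1 Ω) := isClosed_H1.completeSpace_coe

lemma IsTestFunction.add {V : Type*} [NormedAddCommGroup V] [NormedSpace ℝ V]
    {φ ψ : EuclideanSpace ℝ (Fin n) → V} (hφ : IsTestFunction Ω φ) (hψ : IsTestFunction Ω ψ) :
    IsTestFunction Ω (fun x => φ x + ψ x) where
  smooth := hφ.smooth.add hψ.smooth
  compact := hφ.compact.add hψ.compact
  support := (tsupport_add φ ψ).trans (Set.union_subset hφ.support hψ.support)

lemma IsTestFunction.comp_left {V W : Type*} [NormedAddCommGroup V] [NormedSpace ℝ V]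
    [NormedAddCommGroup W] [NormedSpace ℝ W] {φ : EuclideanSpace ℝ (Fin n) → V}
    (hφ : IsTestFunction Ω φ) (L : V →L[ℝ] W) : IsTestFunction Ω (fun x => L (φ x)) where
  smooth := L.contDiff.comp hφ.smooth
  compact := hφ.compact.comp_left (map_zero L)
  support := (tsupport_comp_subset (map_zero L) φ).trans hφ.support

/-- The elements of `H¹` given by test functions. -/
def testH1 (Ω : Set (EuclideanSpace ℝ (Fin n))) : Submodule ℝ (H1 Ω) where
  carrier := {F | ∃ φ : EuclideanSpace ℝ (Fin n) → Cl n, IsTestFunction Ω φ ∧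
    toFn F =ᵐ[volume.restrict Ω] φ}
  add_mem' := by
    rintro F G ⟨φ, hφ, hF⟩ ⟨ψ, hψ, hG⟩
    refine ⟨_, hφ.add hψ, ?_⟩
    filter_upwards [Lp.coeFn_add (toFn F) (toFn G), hF, hG] with x hx hFx hGx
    rw [← hFx, ← hGx]
    exact hx
  zero_mem' := by
    refine ⟨fun _ => 0, ⟨contDiff_const, HasCompactSupport.zero, ?_⟩, Lp.coeFn_zero _ _ _⟩
    simp [tsupport, Function.support]
  smul_mem' := by
    rintro c F ⟨φ, hφ, hF⟩
    refine ⟨_, hφ.comp_left (c • ContinuousLinearMap.id ℝ (Cl n)), ?_⟩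
    filter_upwards [Lp.coeFn_smul c (toFn F), hF] with x hx hFx
    simp only [smul_apply, ContinuousLinearMap.id_apply, ← hFx]
    exact hx

/-- `H¹₀` as a submodule of `H¹`. -/
def H10Submodule (Ω : Set (EuclideanSpace ℝ (Fin n))) : Submodule ℝ (H1 Ω) :=
  (testH1 Ω).topologicalClosure

instance : CompleteSpace (H10Submodule Ω) :=
  (testH1 Ω).isClosed_topologicalClosure.completeSpace_coe

/-- Componentwise right multiplication by a Clifford number on `L2Grad`. -/
def mulRightL2Grad (Ω : Set (EuclideanSpace ℝ (Fin n))) (a : Cl n) : L2Grad Ω →L[ℝ] L2Grad Ω :=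
  (WithLp.prodContinuousLinearEquiv 2 ℝ _ _).symm.toContinuousLinearMap.comp
    (((mulRightL2 Ω a).comp (valL Ω)).prod
      ((PiLp.continuousLinearEquiv 2 ℝ (fun _ : Fin n => L2 Ω)).symm.toContinuousLinearMap.comp
        (ContinuousLinearMap.pi fun j => (mulRightL2 Ω a).comp (gradL Ω j))))

lemma integral_smul_mulRightL2 {φ : EuclideanSpace ℝ (Fin n) → ℝ}
    (h : MemLp φ 2 (volume.restrict Ω)) (F : L2 Ω) (a : Cl n) :
    ∫ x in Ω, φ x • mulRightL2 Ω a F x = (∫ x in Ω, φ x • F x) * a := by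
  refine Eq.trans (integral_congr_ae ?_)
    ((Cl.mulRightL a).integral_comp_comm (integrable_smul_L2 h F))
  filter_upwards [coeFn_mulRightL2 a F] with x hx
  rw [hx, Cl.mulRightL_apply, smul_mul_assoc]

lemma mulRightL2Grad_mem_H1 (a : Cl n) {u : L2Grad Ω} (hu : u ∈ H1 Ω) :
    mulRightL2Grad Ω a u ∈ H1 Ω := by
  intro j φ hφ
  change ∫ x in Ω, pderiv j φ x • mulRightL2 Ω a u.fst x
    = -∫ x in Ω, φ x • mulRightL2 Ω a (u.snd j) x
  rw [integral_smul_mulRightL2 (hφ.memLp_pderiv j), integral_smul_mulRightL2 hφ.memLp,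
    hu j φ hφ, neg_mul]

/-- Right multiplication by a Clifford number on `H¹`. -/
def mulRightH1 (Ω : Set (EuclideanSpace ℝ (Fin n))) (a : Cl n) : H1 Ω →L[ℝ] H1 Ω :=
  ((mulRightL2Grad Ω a).comp (H1 Ω).subtypeL).codRestrict (H1 Ω)
    fun F => mulRightL2Grad_mem_H1 a F.2

/-- Right multiplication is continuous and preserves test functions, hence also the closure of their
set. -/
lemma mulRightH1_mem_H10 (a : Cl n) {F : H1 Ω} (hF : F ∈ H10 Ω) : mulRightH1 Ω a F ∈ H10 Ω := by
  refine map_mem_closure (mulRightH1 Ω a).continuous hF ?_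
  rintro G ⟨φ, hφ, hG⟩
  refine ⟨_, hφ.comp_left (Cl.mulRightL a), ?_⟩
  filter_upwards [coeFn_mulRightL2 a (toFn G), hG] with x hx hGx
  rw [← hGx]
  exact hx

lemma sc_add (x y : Cl n) : Cl.sc (x + y) = Cl.sc x + Cl.sc y := rfl

lemma mulRightH1_one (G : H1 Ω) : mulRightH1 Ω 1 G = G := by
  have h : ∀ F : L2 Ω, mulRightL2 Ω 1 F = F := by
    intro F
    refine Lp.ext ?_
    filter_upwards [coeFn_mulRightL2 1 F] with x hx
    rw [hx, mul_one]
  refine Subtype.ext (WithLp.ofLp_injective 2 (Prod.ext (h _) (PiLp.ext fun j => h _)))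

/-! ### The Dirac operator and the sesquilinear form -/

section Form

variable [NeZero n]
  (hw : MemLp (fun x : EuclideanSpace ℝ (Fin n) => x (lastIdx n)) ⊤ (volume.restrict Ω))

/-- The hyperbolic Dirac operator as a bounded operator on `L2Grad`. -/
def diracL : L2Grad Ω →L[ℝ] L2 Ω :=
  (∑ i, (mulLeftL2 Ω (Cl.e i)).comp ((weightL2 hw).comp (gradL Ω i)))
    - alpha n • (mulLeftL2 Ω (Cl.e (lastIdx n))).comp (valL Ω)

lemma diracL_apply (u : L2Grad Ω) :
    diracL hw u = (∑ i, mulLeftL2 Ω (Cl.e i) (weightL2 hw (gradL Ω i u)))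
      - alpha n • mulLeftL2 Ω (Cl.e (lastIdx n)) (valL Ω u) := by
  simp [diracL, sum_apply]

lemma diracH_ae_eq (F : H1 Ω) : diracH F =ᵐ[volume.restrict Ω] diracL hw F.1 := by
  have hsum : ((∑ i, mulLeftL2 Ω (Cl.e i) (weightL2 hw (gradL Ω i F.1)) : L2 Ω) :
      EuclideanSpace ℝ (Fin n) → Cl n) =ᵐ[volume.restrict Ω]
      ∑ i, (mulLeftL2 Ω (Cl.e i) (weightL2 hw (gradL Ω i F.1)) :
        EuclideanSpace ℝ (Fin n) → Cl n) := Lp.coeFn_finsetSum _ _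
  have hterm : ∀ᵐ x ∂volume.restrict Ω, ∀ i,
      mulLeftL2 Ω (Cl.e i) (weightL2 hw (gradL Ω i F.1)) x
        = Cl.e i * (x (lastIdx n) • wderiv F i x) := by
    rw [ae_all_iff]
    intro i
    filter_upwards [coeFn_mulLeftL2 (Cl.e i) (weightL2 hw (gradL Ω i F.1)),
      coeFn_weightL2 hw (gradL Ω i F.1)] with x h1 h2
    rw [h1, h2]
    rfl
  rw [diracL_apply]
  filter_upwards [Lp.coeFn_sub (∑ i, mulLeftL2 Ω (Cl.e i) (weightL2 hw (gradL Ω i F.1)))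
      (alpha n • mulLeftL2 Ω (Cl.e (lastIdx n)) (valL Ω F.1)),
    Lp.coeFn_smul (alpha n) (mulLeftL2 Ω (Cl.e (lastIdx n)) (valL Ω F.1)),
    coeFn_mulLeftL2 (Cl.e (lastIdx n)) (valL Ω F.1), hsum, hterm] with x h1 h2 h3 h4 h5
  -- `diracL` sums over all indices while `diracH` keeps the last one apart, so that term is split
  -- off.
  rw [h1, Pi.sub_apply, h2, Pi.smul_apply, h3, h4, Finset.sum_apply,
    Finset.sum_congr rfl fun i _ => h5 i,
    ← Finset.add_sum_erase Finset.univ _ (Finset.mem_univ (lastIdx n)), diracH]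
  change _ = _ - alpha n • (Cl.e (lastIdx n) * toFn F x)
  abel

/-- The part of the operator `Q_s(D_H)` of order at most one. -/
def lowerOrderL (s : Cl n) : L2Grad Ω →L[ℝ] L2 Ω :=
  (2 * (1 + alpha n)) • (weightL2 hw).comp (gradL Ω (lastIdx n))
    + (mulLeftL2 Ω (Cl.e (lastIdx n) - (2 * Cl.sc s) • (1 : Cl n))).comp (diracL hw)
    + (‖s‖ ^ 2 - beta n) • valL Ω

lemma lowerOrderL_apply (s : Cl n) (u : L2Grad Ω) :
    lowerOrderL hw s u = (2 * (1 + alpha n)) • weightL2 hw (gradL Ω (lastIdx n) u)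
      + mulLeftL2 Ω (Cl.e (lastIdx n) - (2 * Cl.sc s) • (1 : Cl n)) (diracL hw u)
      + (‖s‖ ^ 2 - beta n) • valL Ω u := rfl

/-- The weight `y²` is written as `y` applied twice, so that one factor can later move to the other
argument and leave `‖y ∂_i u‖²` on the diagonal. -/
lemma qForm_eq_pairingL (s : Cl n) (F G : H1 Ω) :
    qForm s F G = (∑ i, pairingL Ω (weightL2 hw (weightL2 hw (gradL Ω i F.1))) (gradL Ω i G.1))
      + pairingL Ω (lowerOrderL hw s F.1) (valL Ω G.1) := by
  have h1 : ∀ i, pairing Ω (fun x => x (lastIdx n) ^ 2 • wderiv F i x) (wderiv G i)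
      = pairingL Ω (weightL2 hw (weightL2 hw (gradL Ω i F.1))) (gradL Ω i G.1) := by
    intro i
    refine pairing_eq_pairingL ?_ (ae_eq_refl _)
    filter_upwards [coeFn_weightL2 hw (weightL2 hw (gradL Ω i F.1)),
      coeFn_weightL2 hw (gradL Ω i F.1)] with x h1 h2
    rw [h1, h2, smul_smul, ← sq]
    rfl
  have h2 : pairing Ω (fun x => x (lastIdx n) • wderiv F (lastIdx n) x) (toFn G)
      = pairingL Ω (weightL2 hw (gradL Ω (lastIdx n) F.1)) (valL Ω G.1) :=
    pairing_eq_pairingL (coeFn_weightL2 hw _).symm (ae_eq_refl _)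
  have h3 : pairing Ω
      (fun x => (Cl.e (lastIdx n) - (2 * Cl.sc s) • (1 : Cl n)) * diracH F x) (toFn G)
      = pairingL Ω (mulLeftL2 Ω (Cl.e (lastIdx n) - (2 * Cl.sc s) • (1 : Cl n)) (diracL hw F.1))
        (valL Ω G.1) := by
    refine pairing_eq_pairingL ?_ (ae_eq_refl _)
    filter_upwards [coeFn_mulLeftL2 (Cl.e (lastIdx n) - (2 * Cl.sc s) • (1 : Cl n))
      (diracL hw F.1), diracH_ae_eq hw F] with x h1 h2
    rw [h1, h2]
  have h4 : pairing Ω (fun x => (‖s‖ ^ 2 - beta n) • toFn F x) (toFn G)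
      = pairingL Ω ((‖s‖ ^ 2 - beta n) • valL Ω F.1) (valL Ω G.1) :=
    pairing_eq_pairingL (Lp.coeFn_smul (‖s‖ ^ 2 - beta n) (valL Ω F.1)).symm (ae_eq_refl _)
  rw [qForm, Finset.sum_congr rfl fun i _ => h1 i, h1, h2, h3, h4,
    ← Finset.add_sum_erase Finset.univ _ (Finset.mem_univ (lastIdx n)), lowerOrderL_apply]
  simp only [map_add, map_smul, add_apply, smul_apply]
  abel

/-- The scalar part of the sesquilinear form, as a continuous real bilinear form on `L2Grad`. -/
def scFormL (s : Cl n) : L2Grad Ω →L[ℝ] L2Grad Ω →L[ℝ] ℝ :=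
  (∑ i, (innerSL ℝ).bilinearComp ((weightL2 hw).comp ((weightL2 hw).comp (gradL Ω i)))
      (gradL Ω i))
    + (innerSL ℝ).bilinearComp (lowerOrderL hw s) (valL Ω)

lemma scFormL_apply (s : Cl n) (u v : L2Grad Ω) :
    scFormL hw s u v
      = (∑ i, inner ℝ (weightL2 hw (weightL2 hw (gradL Ω i u))) (gradL Ω i v))
        + inner ℝ (lowerOrderL hw s u) (valL Ω v) := by
  simp [scFormL, sum_apply]

lemma sc_qForm_mul (s : Cl n) (F G : H1 Ω) (a : Cl n) :
    Cl.sc (qForm s F G * a) = scFormL hw s F.1 (mulRightH1 Ω a G).1 := by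
  rw [qForm_eq_pairingL hw, add_mul, Finset.sum_mul, sc_add, scFormL_apply, sc_pairingL_mul,
    ← Cl.scL_apply, map_sum]
  simp only [Cl.scL_apply, sc_pairingL_mul]
  rfl

/-- Reduction to a real problem. One direction takes scalar parts (`a = 1`); the other tests the
real equation with `G a` for every Clifford number `a`. -/
lemma isWeakSolution_iff (s : Cl n) (f : L2 Ω) (F : H1 Ω) :
    IsWeakSolution s f F ↔
      F ∈ H10 Ω ∧ ∀ G ∈ H10 Ω, scFormL hw s F.1 G.1 = inner ℝ f (valL Ω G.1) := by
  have hpair : ∀ (G : H1 Ω) (a : Cl n),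
      Cl.sc (pairing Ω f (toFn G) * a) = inner ℝ f (valL Ω (mulRightH1 Ω a G).1) := fun G a => by
    rw [pairing_eq_pairingL (ae_eq_refl _) (ae_eq_refl _), sc_pairingL_mul]
    rfl
  refine and_congr_right fun _ => ⟨fun h G hG => ?_, fun h G hG => ?_⟩
  · rw [← mulRightH1_one G, ← sc_qForm_mul, ← hpair, h G hG]
  · refine Cl.eq_of_sc_mul_eq fun a => ?_
    rw [sc_qForm_mul hw, hpair]
    exact h _ (mulRightH1_mem_H10 a hG)

/-! ### Estimates -/

lemma norm_diracL_le {M : ℝ} (hM0 : 0 ≤ M) (hα : 0 ≤ alpha n)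
    (hM : ∀ᵐ x ∂volume.restrict Ω, |x (lastIdx n)| ≤ M) (u : L2Grad Ω) :
    ‖diracL hw u‖ ≤ M * √(n : ℝ) * √(∑ i, ‖gradL Ω i u‖ ^ 2) + alpha n * ‖valL Ω u‖ := by
  have he : ∀ (i : Fin n) (F : L2 Ω), ‖mulLeftL2 Ω (Cl.e i) F‖ ≤ ‖F‖ := fun i F => by
    simpa using norm_mulLeftL2_le (a := Cl.e i) (C := 1) (fun x => by simp [Cl.norm_e_mul]) F
  rw [diracL_apply]
  refine (norm_sub_le _ _).trans (add_le_add ?_ ?_)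
  · calc ‖∑ i, mulLeftL2 Ω (Cl.e i) (weightL2 hw (gradL Ω i u))‖
        ≤ ∑ i, M * ‖gradL Ω i u‖ :=
          norm_sum_le_of_le _ fun i _ => (he i _).trans (norm_weightL2_le hw hM _)
      _ = M * ∑ i, ‖gradL Ω i u‖ := by rw [Finset.mul_sum]
      -- Cauchy–Schwarz over the `n` partial derivatives produces the factor `√n`.
      _ ≤ M * √(n * ∑ i, ‖gradL Ω i u‖ ^ 2) := by
          refine mul_le_mul_of_nonneg_left (Real.le_sqrt_of_sq_le ?_) hM0
          simpa using sq_sum_le_card_mul_sum_sq (s := Finset.univ)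
            (f := fun i : Fin n => ‖gradL Ω i u‖)
      _ = _ := by rw [Real.sqrt_mul (Nat.cast_nonneg n), mul_assoc]
  · rw [norm_smul, Real.norm_of_nonneg hα]
    exact mul_le_mul_of_nonneg_left (he _ _) hα

/-- Symmetry of the weight makes the leading terms equal to `‖y ∂_i u‖²`. The first-order term and
the Dirac term have no sign and are bounded by Cauchy–Schwarz. The zeroth-order part of `D_H` costs
`α_n r q²`, which lowers the coefficient of `q²`. -/
lemma le_scFormL_self {m M : ℝ} (hm : 0 < m) (hM0 : 0 ≤ M) (hα : 0 ≤ alpha n)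
    (hmw : ∀ᵐ x ∂volume.restrict Ω, m ≤ |x (lastIdx n)|)
    (hM : ∀ᵐ x ∂volume.restrict Ω, |x (lastIdx n)| ≤ M) (s : Cl n) (u : L2Grad Ω) :
    m ^ 2 * √(∑ i, ‖gradL Ω i u‖ ^ 2) ^ 2
      - M * (2 * (1 + alpha n) + √(n : ℝ) * √(1 + 4 * Cl.sc s ^ 2))
        * (√(∑ i, ‖gradL Ω i u‖ ^ 2) * ‖valL Ω u‖)
      + (‖s‖ ^ 2 - beta n - alpha n * √(1 + 4 * Cl.sc s ^ 2)) * ‖valL Ω u‖ ^ 2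
      ≤ scFormL hw s u u := by
  set p := √(∑ i, ‖gradL Ω i u‖ ^ 2) with hp
  set q := ‖valL Ω u‖ with hq
  set r := √(1 + 4 * Cl.sc s ^ 2) with hr
  have hp2 : p ^ 2 = ∑ i, ‖gradL Ω i u‖ ^ 2 := Real.sq_sqrt (Finset.sum_nonneg fun _ _ => sq_nonneg _)
  have hgrad : ‖gradL Ω (lastIdx n) u‖ ≤ p := by
    refine Real.le_sqrt_of_sq_le ?_
    exact Finset.single_le_sum (f := fun i => ‖gradL Ω i u‖ ^ 2) (fun i _ => sq_nonneg _)
      (Finset.mem_univ _)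
  have h1 : m ^ 2 * p ^ 2
      ≤ ∑ i, inner ℝ (weightL2 hw (weightL2 hw (gradL Ω i u))) (gradL Ω i u) := by
    rw [hp2, Finset.mul_sum]
    refine Finset.sum_le_sum fun i _ => ?_
    rw [inner_weightL2_left, real_inner_self_eq_norm_sq, ← mul_pow]
    exact pow_le_pow_left₀ (mul_nonneg hm.le (norm_nonneg _)) (le_norm_weightL2 hw hm hmw _) 2
  have h2 : -(M * p * q) ≤ inner ℝ (weightL2 hw (gradL Ω (lastIdx n) u)) (valL Ω u) := by
    refine neg_le_of_abs_le ((abs_real_inner_le_norm _ _).trans ?_)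
    refine mul_le_mul_of_nonneg_right ?_ (norm_nonneg _)
    exact (norm_weightL2_le hw hM _).trans (mul_le_mul_of_nonneg_left hgrad hM0)
  have h3 : -(r * (M * √(n : ℝ) * p + alpha n * q) * q) ≤
      inner ℝ (mulLeftL2 Ω (Cl.e (lastIdx n) - (2 * Cl.sc s) • (1 : Cl n)) (diracL hw u))
        (valL Ω u) := by
    refine neg_le_of_abs_le ((abs_real_inner_le_norm _ _).trans ?_)
    refine mul_le_mul_of_nonneg_right ?_ (norm_nonneg _)
    refine (norm_mulLeftL2_le (C := r) (fun x => ?_) _).trans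
      (mul_le_mul_of_nonneg_left (norm_diracL_le hw hM0 hα hM u) (Real.sqrt_nonneg _))
    rw [sub_eq_add_neg, ← neg_smul, Cl.norm_e_add_smul_one_mul, hr]
    refine le_of_eq ?_
    congr 3
    ring
  have h4 : (inner ℝ (valL Ω u) (valL Ω u) : ℝ) = q ^ 2 := real_inner_self_eq_norm_sq _
  have h5 := mul_le_mul_of_nonneg_left h2 (show 0 ≤ 2 * (1 + alpha n) by positivity)
  rw [scFormL_apply, lowerOrderL_apply, inner_add_left, inner_add_left, real_inner_smul_left,
    real_inner_smul_left, h4]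
  linarith

end Form

/-! ### A two-variable quadratic form and the Lax–Milgram theorem. -/

/-- The least eigenvalue of the matrix `[[c, -B/2], [-B/2, A]]` bounds its quadratic form below. -/
lemma least_eigenvalue_mul_le (A B c p q : ℝ) (hB : 0 ≤ B) :
    (1 / 2 * (A + c) - 1 / 2 * √((A - c) ^ 2 + B ^ 2)) * (p ^ 2 + q ^ 2)
      ≤ c * p ^ 2 - B * (p * q) + A * q ^ 2 := by
  set R := √((A - c) ^ 2 + B ^ 2) with hR
  have hR2 : R ^ 2 = (A - c) ^ 2 + B ^ 2 := Real.sq_sqrt (by positivity)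
  obtain ⟨h2, h1⟩ := abs_le.mp (Real.abs_le_sqrt (x := A - c) (y := (A - c) ^ 2 + B ^ 2)
    (by nlinarith))
  -- With `λ` the least eigenvalue, these are `c - λ` and `A - λ`. Their product is `B² / 4`, so the
  -- form minus `λ (p² + q²)` is a perfect square.
  have ha : 0 ≤ (R - (A - c)) / 2 := by linarith
  have hb : 0 ≤ (R + (A - c)) / 2 := by linarith
  have hab : √((R - (A - c)) / 2) * √((R + (A - c)) / 2) = B / 2 := by
    rw [← Real.sqrt_mul ha, Real.sqrt_eq_iff_mul_self_eq (by positivity) (by positivity)]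
    linarith
  have h := sq_nonneg (√((R - (A - c)) / 2) * p - √((R + (A - c)) / 2) * q)
  have h' : (√((R - (A - c)) / 2) * p - √((R + (A - c)) / 2) * q) ^ 2
      = (R - (A - c)) / 2 * p ^ 2 - B * (p * q) + (R + (A - c)) / 2 * q ^ 2 := by
    rw [sub_sq, mul_pow, mul_pow, Real.sq_sqrt ha, Real.sq_sqrt hb]
    linear_combination (-2 * p * q) * hab
  linarith

/-- Since `(A + c)² - (A - c)² = 4 A c`, positive trace and determinant suffice. -/
lemma least_eigenvalue_pos {A B c : ℝ} (htr : 0 < A + c) (hdet : B ^ 2 < 4 * c * A) :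
    0 < 1 / 2 * (A + c) - 1 / 2 * √((A - c) ^ 2 + B ^ 2) := by
  have : √((A - c) ^ 2 + B ^ 2) < A + c := by
    rw [Real.sqrt_lt' htr]
    linarith [add_sq A c, sub_sq A c]
  linarith

/-- The Lax–Milgram theorem, for functionals. -/
lemma existsUnique_of_coercive {V : Type*} [NormedAddCommGroup V] [InnerProductSpace ℝ V]
    [CompleteSpace V] (B : V →L[ℝ] V →L[ℝ] ℝ) (hc : IsCoercive B) (ℓ : V →L[ℝ] ℝ) :
    ∃! v, ∀ w, B v w = ℓ w := by
  refine ⟨hc.continuousLinearEquivOfBilin.symm ((InnerProductSpace.toDual ℝ V).symm ℓ),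
    fun w => ?_, fun v hv => ?_⟩
  · rw [← hc.continuousLinearEquivOfBilin_apply, ContinuousLinearEquiv.apply_symm_apply,
      InnerProductSpace.toDual_symm_apply]
  · rw [ContinuousLinearEquiv.eq_symm_apply]
    refine (hc.unique_continuousLinearEquivOfBilin fun w => ?_).symm
    rw [InnerProductSpace.toDual_symm_apply, hv]

/-- The Lax–Milgram theorem on an isometrically embedded Hilbert space. -/
lemma existsUnique_comp_of_coercive {V E : Type*} [NormedAddCommGroup V] [InnerProductSpace ℝ V]
    [CompleteSpace V] [NormedAddCommGroup E] [InnerProductSpace ℝ E] (ι : V →ₗᵢ[ℝ] E)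
    (B : E →L[ℝ] E →L[ℝ] ℝ) {K : ℝ} (hK : 0 < K) (hB : ∀ v, K * ‖v‖ ^ 2 ≤ B v v)
    (ℓ : E →L[ℝ] ℝ) : ∃! v, ∀ w, B (ι v) (ι w) = ℓ (ι w) := by
  refine existsUnique_of_coercive
    (B.bilinearComp ι.toContinuousLinearMap ι.toContinuousLinearMap) ⟨K, hK, fun v => ?_⟩
    (ℓ.comp ι.toContinuousLinearMap)
  rw [mul_assoc, ← sq, ← ι.norm_map]
  exact hB (ι v)

/-- The Lax–Milgram theorem on a complete subspace. -/
lemma existsUnique_mem_of_coercive {E : Type*} [NormedAddCommGroup E] [InnerProductSpace ℝ E]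
    (H : Submodule ℝ E) (W : Submodule ℝ H) [CompleteSpace W] (B : E →L[ℝ] E →L[ℝ] ℝ) {K : ℝ}
    (hK : 0 < K) (hB : ∀ v, K * ‖v‖ ^ 2 ≤ B v v) (ℓ : E →L[ℝ] ℝ) :
    ∃! v : H, v ∈ W ∧ ∀ w ∈ W, B v w = ℓ w := by
  obtain ⟨v, hv, huniq⟩ :=
    existsUnique_comp_of_coercive (V := W) ⟨H.subtype ∘ₗ W.subtype, fun _ => rfl⟩ B hK hB ℓ
  refine ⟨v.1, ⟨v.2, fun w hw => hv ⟨w, hw⟩⟩, fun v' hv' => ?_⟩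
  exact congrArg Subtype.val (huniq ⟨v', hv'.1⟩ fun w => hv'.2 w.1 w.2)

/-! ### Positivity of the constant, solvability and the resolvent estimate. -/

theorem mainTheorem2 (n : ℕ) [n.AtLeastTwo] (m M : ℝ) (hm : 0 < m) (hmM : m < M)
    (Ω : Set (EuclideanSpace ℝ (Fin n))) (hΩ : IsOpen Ω)
    (hinf : IsGLB ((fun x : EuclideanSpace ℝ (Fin n) => x (lastIdx n)) '' Ω) m)
    (hsup : IsLUB ((fun x : EuclideanSpace ℝ (Fin n) => x (lastIdx n)) '' Ω) M)
    (s : Cl n) (hs : s ∈ Cl.paravectors n)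
    (hcond₁ : |‖s‖ ^ 2 - beta n| - alpha n * √(1 + 4 * Cl.sc s ^ 2) + m ^ 2 > 0)
    (hcond₂ : 4 * m ^ 2 * |‖s‖ ^ 2 - beta n| - 4 * n * M ^ 2 * Cl.sc s ^ 2
        - 4 * (m ^ 2 * alpha n + M ^ 2 * (1 + alpha n) * √(n : ℝ)) * √(1 + 4 * Cl.sc s ^ 2)
      > M ^ 2 * (4 * (1 + alpha n) ^ 2 + n)) :
    0 < coercivityConst m M s ∧
    ∀ f : L2 Ω,
      (∃! F : H1 Ω, IsWeakSolution s f F) ∧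
      MemLp (rightSResolvent s f) 2 (volume.restrict Ω) ∧
      (eLpNorm (rightSResolvent s f) 2 (volume.restrict Ω)).toReal
        ≤ (‖s‖ + alpha n + M * √(n : ℝ)) * (1 / coercivityConst m M s) * ‖f‖ := by
  have hM0 : 0 < M := hm.trans hmM
  have hn : (2 : ℝ) ≤ n := by exact_mod_cast Nat.AtLeastTwo.prop
  have hα : 0 ≤ alpha n := by unfold alpha; linarith
  set r := √(1 + 4 * Cl.sc s ^ 2) with hr
  have hr0 : 0 ≤ r := Real.sqrt_nonneg _
  have hr2 : r ^ 2 = 1 + 4 * Cl.sc s ^ 2 := Real.sq_sqrt (by positivity)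
  have hn2 : √(n : ℝ) ^ 2 = n := Real.sq_sqrt (by positivity)
  have hmM2 : m ^ 2 ≤ M ^ 2 := pow_le_pow_left₀ hm.le hmM.le 2
  -- the second condition excludes `‖s‖ ^ 2 < beta n`
  have habs : |‖s‖ ^ 2 - beta n| = ‖s‖ ^ 2 - beta n := by
    refine abs_of_nonneg (le_of_not_gt fun hneg => ?_)
    rw [abs_of_neg hneg] at hcond₂
    have h1 : 0 ≤ 4 * (m ^ 2 * alpha n + M ^ 2 * (1 + alpha n) * √(n : ℝ)) * r := by positivity
    have h2 : 0 ≤ 4 * n * M ^ 2 * Cl.sc s ^ 2 := by positivity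
    -- If `|s|² < β_n`, the left side of `hcond₂` is at most `4 M² β_n`. As `β_n = α_n (1 + α_n) ≤
    -- (1 + α_n)²`, this does not exceed the right side.
    have h3 : m ^ 2 * (beta n - ‖s‖ ^ 2) ≤ M ^ 2 * beta n := by
      refine mul_le_mul hmM2 (by linarith [sq_nonneg ‖s‖]) (by linarith) (by positivity)
    have h4 : M ^ 2 * (4 * beta n) ≤ M ^ 2 * (4 * (1 + alpha n) ^ 2 + n) := by
      refine mul_le_mul_of_nonneg_left ?_ (by positivity)
      unfold beta
      nlinarith
    linarith
  set A := ‖s‖ ^ 2 - beta n - alpha n * r with hA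
  set B := M * (2 * (1 + alpha n) + √(n : ℝ) * r) with hB
  have hB0 : 0 ≤ B := by positivity
  have hKeq : coercivityConst m M s
      = 1 / 2 * (A + m ^ 2) - 1 / 2 * √((A - m ^ 2) ^ 2 + B ^ 2) := by
    rw [coercivityConst, habs, ← hr, hA, hB, mul_pow M]
    ring
  have hK : 0 < coercivityConst m M s := by
    rw [hKeq]
    rw [habs] at hcond₁ hcond₂
    refine least_eigenvalue_pos hcond₁ ?_
    -- Expanding with `r² = 1 + 4 s₀²` shows that `hcond₂` is exactly `B² < 4 m² A`; `hcond₁` was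
    -- the trace condition `A + m² > 0`.
    have hB2 : B ^ 2 = M ^ 2 * (4 * (1 + alpha n) ^ 2 + n) + 4 * n * M ^ 2 * Cl.sc s ^ 2
        + 4 * (M ^ 2 * (1 + alpha n) * √(n : ℝ)) * r := by
      rw [hB]
      linear_combination M ^ 2 * r ^ 2 * hn2 + M ^ 2 * n * hr2
    rw [hB2, hA]
    linarith
  set K := coercivityConst m M s
  have hbounds : ∀ᵐ x ∂volume.restrict Ω, m ≤ |x (lastIdx n)| ∧ |x (lastIdx n)| ≤ M := by
    filter_upwards [ae_restrict_mem hΩ.measurableSet] with x hx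
    have h1 : m ≤ x (lastIdx n) := hinf.1 ⟨x, hx, rfl⟩
    have h2 : x (lastIdx n) ≤ M := hsup.1 ⟨x, hx, rfl⟩
    rw [abs_of_nonneg (hm.le.trans h1)]
    exact ⟨h1, h2⟩
  have hmw := hbounds.mono fun x h => h.1
  have hMw := hbounds.mono fun x h => h.2
  have hw : MemLp (fun x : EuclideanSpace ℝ (Fin n) => x (lastIdx n)) ⊤ (volume.restrict Ω) :=
    memLp_top_of_bound (by fun_prop) M hMw
  have hcoer : ∀ u : L2Grad Ω, K * ‖u‖ ^ 2 ≤ scFormL hw s u u := by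
    intro u
    refine le_trans ?_ (le_scFormL_self hw hm hM0.le hα hmw hMw s u)
    have h := least_eigenvalue_mul_le A B (m ^ 2) (√(∑ i, ‖gradL Ω i u‖ ^ 2)) ‖valL Ω u‖ hB0
    rw [← hKeq] at h
    rw [L2Grad_norm_sq, add_comm]
    rwa [Real.sq_sqrt (Finset.sum_nonneg fun _ _ => sq_nonneg _)] at h ⊢
  refine ⟨hK, fun f => ?_⟩
  have hex : ∃! F : H1 Ω, IsWeakSolution s f F := by
    obtain ⟨F, hF, huniq⟩ := existsUnique_mem_of_coercive (H1 Ω) (H10Submodule Ω) (scFormL hw s) hK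
      hcoer (((innerSL ℝ) f).comp (valL Ω))
    -- Membership in `H10Submodule Ω` unfolds to membership in `H10 Ω`: both are the closure of the
    -- same set.
    exact ⟨F, (isWeakSolution_iff hw s f _).mpr hF,
      fun F' hF' => huniq F' ((isWeakSolution_iff hw s f _).mp hF')⟩
  set F := pseudoSResolvent s f with hFdef
  have hF : IsWeakSolution s f F := Classical.epsilon_spec hex.exists
  obtain ⟨hF0, hFsol⟩ := (isWeakSolution_iff hw s f _).mp hF
  have hvalle : ∀ u : L2Grad Ω, ‖valL Ω u‖ ≤ ‖u‖ := fun u => by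
    refine (sq_le_sq₀ (norm_nonneg _) (norm_nonneg _)).mp ?_
    rw [L2Grad_norm_sq]
    exact le_add_of_nonneg_right (Finset.sum_nonneg fun _ _ => sq_nonneg _)
  have hgradle : ∀ u : L2Grad Ω, √(∑ i, ‖gradL Ω i u‖ ^ 2) ≤ ‖u‖ := fun u => by
    rw [Real.sqrt_le_left (norm_nonneg _), L2Grad_norm_sq]
    exact le_add_of_nonneg_left (sq_nonneg _)
  have hFle : ‖F.1‖ ≤ 1 / K * ‖f‖ := by
    rw [one_div, le_inv_mul_iff₀ hK]
    -- The solution lies in `H¹₀`, so it may serve as its own test function.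
    have h1 : K * ‖F.1‖ * ‖F.1‖ ≤ ‖f‖ * ‖F.1‖ := by
      calc K * ‖F.1‖ * ‖F.1‖ = K * ‖F.1‖ ^ 2 := by ring
        _ ≤ inner ℝ f (valL Ω F.1) := (hcoer _).trans_eq (hFsol F hF0)
        _ ≤ ‖f‖ * ‖valL Ω F.1‖ := real_inner_le_norm _ _
        _ ≤ ‖f‖ * ‖F.1‖ := mul_le_mul_of_nonneg_left (hvalle _) (norm_nonneg _)
    rcases (norm_nonneg F.1).eq_or_lt with h0 | h0
    · rw [← h0, mul_zero]
      exact norm_nonneg _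
    · exact le_of_mul_le_mul_right h1 h0
  set S : L2 Ω := mulLeftL2 Ω (Cl.conj s) (valL Ω F.1) - diracL hw F.1 with hS
  have hSae : rightSResolvent s f =ᵐ[volume.restrict Ω] S := by
    filter_upwards [Lp.coeFn_sub (mulLeftL2 Ω (Cl.conj s) (valL Ω F.1)) (diracL hw F.1),
      coeFn_mulLeftL2 (Cl.conj s) (valL Ω F.1), diracH_ae_eq hw F] with x h1 h2 h3
    rw [h1, Pi.sub_apply, h2, ← h3]
    rfl
  refine ⟨hex, (Lp.memLp S).ae_eq hSae.symm, ?_⟩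
  rw [eLpNorm_congr_ae hSae, ← Lp.norm_def]
  have hconj : ‖mulLeftL2 Ω (Cl.conj s) (valL Ω F.1)‖ ≤ ‖s‖ * ‖valL Ω F.1‖ :=
    norm_mulLeftL2_le (fun x => by
      rw [Cl.norm_mul_of_mem_paravectors (Cl.conj_mem_paravectors hs), Cl.norm_conj]) _
  -- The `H¹` norm controls both the function and its full gradient, so all three terms are bounded
  -- by `‖F.1‖`.
  calc ‖S‖ ≤ ‖s‖ * ‖valL Ω F.1‖
        + (M * √(n : ℝ) * √(∑ i, ‖gradL Ω i F.1‖ ^ 2) + alpha n * ‖valL Ω F.1‖) :=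
        (norm_sub_le _ _).trans (add_le_add hconj (norm_diracL_le hw hM0.le hα hMw _))
    _ ≤ ‖s‖ * ‖F.1‖ + (M * √(n : ℝ) * ‖F.1‖ + alpha n * ‖F.1‖) := by
        gcongr
        exacts [hvalle _, hgradle _, hvalle _]
    _ = (‖s‖ + alpha n + M * √(n : ℝ)) * ‖F.1‖ := by ring
    _ ≤ (‖s‖ + alpha n + M * √(n : ℝ)) * (1 / K * ‖f‖) :=
        mul_le_mul_of_nonneg_left hFle (by positivity)
    _ = _ := by ring

end
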